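/- Let $\mathcal H$ be a complex Hilbert space with inner product $\langle\cdot,\cdot\rangle$ linear in the second argument, and let $K$ be a bounded and boundedly invertible linear operator on $\mathcal H$. A densely defined closable operator $T$ in $\mathcal H$ is called $K$-invariant if $K^*TK=T$ as operators, that is, $\mathcal D(T)=\{f\in\mathcal H : Kf\in\mathcal D(T)\}$ and $K^*TKf=Tf$ for all $f\in\mathcal D(T)$. Let $A$ be a densely defined sectorial operator in $\mathcal H$: there is $\eta\in[0,\pi/2)$ such that the numerical range $\{\langle\psi,A\psi\rangle : \psi\in\mathcal D(A),\ \|\psi\|=1\}$ is contained in the closed sector $\{0\}\cup\{z\in\mathbb C\setminus\{0\} : -\eta\le\arg z\le\eta\}$. Let $\mathcal Q(A)$ be the set of all $u\in\mathcal H$ for which there is a sequence $(u_n)$ in $\mathcal D(A)$ that converges to $u$ in $\mathcal H$ and is Cauchy with respect to the norm $\|\psi\|_A=(\|\psi\|^2+\operatorname{Re}\langle\psi,A\psi\rangle)^{1/2}$ (we say that $(u_n)$ approximates $u$). For $u,v\in\mathcal Q(A)$ let $\overline{\mathfrak a}[u,v]=\lim_{n\to\infty}\langle u_n,Av_n\rangle$,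 where $(u_n)$ and $(v_n)$ approximate $u$ and $v$; the limit exists and does not depend on the chosen sequences. The Friedrichs extension $A_F$ of $A$ is the operator associated with the closed form $\overline{\mathfrak a}$: $u\in\mathcal D(A_F)$ and $A_Fu=w$ if and only if $u\in\mathcal Q(A)$ and $\overline{\mathfrak a}[v,u]=\langle v,w\rangle$ for all $v\in\mathcal Q(A)$. Theorem. If $K^*AK=A$, then the Friedrichs extension $A_F$ is $K$-invariant; that is, $A_F$ is densely defined and closable, and $K^*A_FK=A_F$. -/

import Mathlib

open Filter Topology

noncomputable section

namespace KInv

section Basic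

variable {H : Type*} [NormedAddCommGroup H] [InnerProductSpace ℂ H]

/-- The numerical range `{⟨ψ, Aψ⟩ | ψ ∈ D(A), ‖ψ‖ = 1}` of an operator `A`. -/
def numericalRange (A : H →ₗ.[ℂ] H) : Set ℂ :=
  {z | ∃ ψ : A.domain, ‖(ψ : H)‖ = 1 ∧ inner ℂ (ψ : H) (A ψ) = z}

/-- `A` is sectorial: it is densely defined and its numerical range is contained in a closed sector
`{z | -η ≤ arg z ≤ η}` with vertex `0` and semi-angle `η ∈ [0, π/2)`.
The vertex belongs to the sector (`Complex.arg 0 = 0`). -/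
structure IsSectorial (A : H →ₗ.[ℂ] H) : Prop where
  dense_domain : Dense (A.domain : Set H)
  numericalRange_subset : ∃ η : ℝ, 0 ≤ η ∧ η < Real.pi / 2 ∧
    numericalRange A ⊆ {z : ℂ | -η ≤ z.arg ∧ z.arg ≤ η}

/-- The sesquilinear form `(u, v) ↦ ⟨u, Av⟩` on `D(A)` (antilinear in `u`, linear in `v`). -/
def form (A : H →ₗ.[ℂ] H) (u v : A.domain) : ℂ := inner ℂ (u : H) (A v)

/-- The form norm `‖ψ‖_A = (‖ψ‖² + Re ⟨ψ, Aψ⟩)^{1/2}` on `D(A)`. -/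
def formNorm (A : H →ₗ.[ℂ] H) (ψ : A.domain) : ℝ :=
  √(‖(ψ : H)‖ ^ 2 + (form A ψ ψ).re)

/-- The sequence `f` in `D(A)` converges to `u` in `H` and is Cauchy for the form norm `‖·‖_A`. -/
def FormConverges (A : H →ₗ.[ℂ] H) (f : ℕ → A.domain) (u : H) : Prop :=
  Tendsto (fun n => (f n : H)) atTop (𝓝 u) ∧
    Tendsto (fun p : ℕ × ℕ => formNorm A (f p.1 - f p.2)) atTop (𝓝 0)

section helpers

variable {A : H →ₗ.[ℂ] H}

lemma form_add_left (u v w : A.domain) : form A (u + v) w = form A u w + form A v w := by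
  simp [form]

lemma form_add_right (u v w : A.domain) : form A u (v + w) = form A u v + form A u w := by
  simp [form, LinearPMap.map_add]

lemma form_sub_left (u v w : A.domain) : form A (u - v) w = form A u w - form A v w := by
  simp [form]

lemma form_sub_right (u v w : A.domain) : form A u (v - w) = form A u v - form A u w := by
  simp [form, LinearPMap.map_sub]

lemma form_smul_left (c : ℂ) (u v : A.domain) :
    form A (c • u) v = (starRingEnd ℂ) c * form A u v := by
  simp only [form, Submodule.coe_smul, inner_smul_left]

lemma form_smul_right (c : ℂ) (u v : A.domain) : form A u (c • v) = c * form A u v := by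
  simp [form, LinearPMap.map_smul]

/-- A sectorial form is bounded on the diagonal by its real part. -/
lemma IsSectorial.exists_bound (hA : IsSectorial A) :
    ∃ M : ℝ, 0 ≤ M ∧ ∀ u : A.domain, 0 ≤ (form A u u).re ∧ ‖form A u u‖ ≤ M * (form A u u).re := by
  obtain ⟨η, h0, h1, hs⟩ := hA.numericalRange_subset
  have hc : 0 < Real.cos η := Real.cos_pos_of_mem_Ioo ⟨by linarith [Real.pi_pos], h1⟩
  refine ⟨(Real.cos η)⁻¹, by positivity, fun u => ?_⟩
  have key : Real.cos η * ‖form A u u‖ ≤ (form A u u).re := by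
    by_cases hu : (u : H) = 0
    · simp [form, hu]
    have hn : 0 < ‖(u : H)‖ := norm_pos_iff.2 hu
    set c : ℂ := ((‖(u : H)‖⁻¹ : ℝ) : ℂ) with hcdef
    have hmem : form A (c • u) (c • u) ∈ numericalRange A := by
      refine ⟨c • u, ?_, rfl⟩
      rw [Submodule.coe_smul, norm_smul, hcdef, Complex.norm_real, norm_inv, norm_norm]
      exact inv_mul_cancel₀ hn.ne'
    have harg := hs hmem
    have hval : form A (c • u) (c • u) = ((‖(u : H)‖⁻¹ ^ 2 : ℝ) : ℂ) * form A u u := by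
      rw [form_smul_left, form_smul_right, hcdef, Complex.conj_ofReal]
      push_cast
      ring
    rw [hval, Set.mem_ofPred_eq, Complex.arg_real_mul _ (by positivity)] at harg
    have hcos : Real.cos η ≤ Real.cos (form A u u).arg := by
      rw [← Real.cos_abs (form A u u).arg]
      exact Real.cos_le_cos_of_nonneg_of_le_pi (abs_nonneg _) (by linarith [Real.pi_pos])
        (abs_le.2 harg)
    calc Real.cos η * ‖form A u u‖ ≤ Real.cos (form A u u).arg * ‖form A u u‖ := by gcongr
      _ = (form A u u).re := by rw [mul_comm, Complex.norm_mul_cos_arg]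
  refine ⟨le_trans (by positivity) key, ?_⟩
  rw [inv_mul_eq_div, le_div_iff₀ hc, mul_comm]
  exact key

lemma IsSectorial.re_nonneg (hA : IsSectorial A) (u : A.domain) : 0 ≤ (form A u u).re :=
  (hA.exists_bound.choose_spec.2 u).1

lemma IsSectorial.re_sub_le (hA : IsSectorial A) (u v : A.domain) :
    (form A (u - v) (u - v)).re ≤ 2 * (form A u u).re + 2 * (form A v v).re := by
  have h := hA.re_nonneg (u + v)
  simp only [form_add_left, form_add_right, form_sub_left, form_sub_right, Complex.add_re,
    Complex.sub_re] at h ⊢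
  linarith

lemma IsSectorial.re_add_le (hA : IsSectorial A) (u v : A.domain) :
    (form A (u + v) (u + v)).re ≤ 2 * (form A u u).re + 2 * (form A v v).re := by
  have h := hA.re_nonneg (u - v)
  simp only [form_add_left, form_add_right, form_sub_left, form_sub_right, Complex.add_re,
    Complex.sub_re] at h ⊢
  linarith

/-- Off-diagonal bound for a sectorial form, by polarization. -/
lemma IsSectorial.exists_bound' (hA : IsSectorial A) :
    ∃ M : ℝ, 0 ≤ M ∧ ∀ (u v : A.domain) (t : ℝ), 0 < t →
      ‖form A u v‖ ≤ M * (t * (form A u u).re + t⁻¹ * (form A v v).re) := by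
  obtain ⟨M, hM, hb⟩ := hA.exists_bound
  have h1 : ∀ u v : A.domain, ‖form A u v‖ ≤ M * ((form A u u).re + (form A v v).re) := by
    intro u v
    have e : 4 * form A u v = form A (u + v) (u + v) - form A (u - v) (u - v)
        - Complex.I * form A (u + Complex.I • v) (u + Complex.I • v)
        + Complex.I * form A (u - Complex.I • v) (u - Complex.I • v) := by
      simp only [form_add_left, form_add_right, form_sub_left, form_sub_right, form_smul_left,
        form_smul_right, Complex.conj_I]
      linear_combination (2 * form A u v - 2 * form A v u) * Complex.I_sq
    have s : (form A (u + v) (u + v)).re + (form A (u - v) (u - v)).re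
        + (form A (u + Complex.I • v) (u + Complex.I • v)).re
        + (form A (u - Complex.I • v) (u - Complex.I • v)).re
        = 4 * ((form A u u).re + (form A v v).re) := by
      simp only [form_add_left, form_add_right, form_sub_left, form_sub_right, form_smul_left,
        form_smul_right, Complex.conj_I, Complex.add_re, Complex.sub_re, Complex.mul_re,
        Complex.I_re, Complex.I_im, Complex.neg_re, Complex.neg_im, Complex.add_im,
        Complex.sub_im, Complex.mul_im]
      ring
    have n4 : 4 * ‖form A u v‖ = ‖4 * form A u v‖ := by simp
    have hn : ‖4 * form A u v‖ ≤ ‖form A (u + v) (u + v)‖ + ‖form A (u - v) (u - v)‖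
        + ‖form A (u + Complex.I • v) (u + Complex.I • v)‖
        + ‖form A (u - Complex.I • v) (u - Complex.I • v)‖ := by
      rw [e]
      refine (norm_add_le _ _).trans (add_le_add ((norm_sub_le _ _).trans
        (add_le_add (norm_sub_le _ _) ?_)) ?_) <;> simp
    nlinarith [(hb (u + v)).2, (hb (u - v)).2, (hb (u + Complex.I • v)).2,
      (hb (u - Complex.I • v)).2]
  refine ⟨M, hM, fun u v t ht => ?_⟩
  have hs : √t * √t = t := Real.mul_self_sqrt ht.le
  have hs0 : √t ≠ 0 := (Real.sqrt_pos.2 ht).ne'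
  have h := h1 (((√t : ℝ) : ℂ) • u) ((((√t)⁻¹ : ℝ) : ℂ) • v)
  have e1 : form A (((√t : ℝ) : ℂ) • u) ((((√t)⁻¹ : ℝ) : ℂ) • v) = form A u v := by
    rw [form_smul_left, form_smul_right, Complex.conj_ofReal, ← mul_assoc, ← Complex.ofReal_mul,
      mul_inv_cancel₀ hs0, Complex.ofReal_one, one_mul]
  have e2 : ∀ (r : ℝ) (x : A.domain), (form A ((r : ℂ) • x) ((r : ℂ) • x)).re
      = r * r * (form A x x).re := by
    intro r x
    rw [form_smul_left, form_smul_right, Complex.conj_ofReal, ← mul_assoc, ← Complex.ofReal_mul,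
      Complex.re_ofReal_mul]
  rwa [e1, e2, e2, hs, ← mul_inv, hs] at h

lemma formConverges_iff (hA : IsSectorial A) (f : ℕ → A.domain) (u : H) :
    FormConverges A f u ↔ Tendsto (fun n => (f n : H)) atTop (𝓝 u) ∧
      Tendsto (fun p : ℕ × ℕ => (form A (f p.1 - f p.2) (f p.1 - f p.2)).re) atTop (𝓝 0) := by
  refine and_congr_right fun hf => ?_
  have hd : Tendsto (fun p : ℕ × ℕ => ‖((f p.1 - f p.2 : A.domain) : H)‖ ^ 2) atTop (𝓝 0) := by
    have h1 : Tendsto (fun p : ℕ × ℕ => (f p.1 : H) - (f p.2 : H)) atTop (𝓝 (u - u)) := by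
      rw [← prod_atTop_atTop_eq]
      exact (hf.comp tendsto_fst).sub (hf.comp tendsto_snd)
    simpa using (h1.norm.pow 2)
  constructor
  · intro h
    have h2 := (h.pow 2).sub hd
    simp only [ne_eq, OfNat.ofNat_ne_zero, not_false_eq_true, zero_pow, sub_zero] at h2
    refine h2.congr fun p => ?_
    rw [formNorm, Real.sq_sqrt (add_nonneg (sq_nonneg _) (hA.re_nonneg _))]
    ring
  · intro h
    have h2 := (hd.add h).sqrt
    simpa [formNorm] using h2

lemma FormConverges.add (hA : IsSectorial A) {f g : ℕ → A.domain} {u v : H}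
    (hf : FormConverges A f u) (hg : FormConverges A g v) :
    FormConverges A (fun n => f n + g n) (u + v) := by
  rw [formConverges_iff hA] at *
  refine ⟨by simpa using hf.1.add hg.1, ?_⟩
  have h := (hf.2.const_mul 2).add (hg.2.const_mul 2)
  simp only [mul_zero, add_zero] at h
  refine squeeze_zero (fun _ => hA.re_nonneg _) (fun p => ?_) h
  have e : f p.1 + g p.1 - (f p.2 + g p.2) = (f p.1 - f p.2) + (g p.1 - g p.2) := by abel
  rw [e]
  exact hA.re_add_le _ _

lemma FormConverges.smul (hA : IsSectorial A) (c : ℂ) {f : ℕ → A.domain} {u : H}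
    (hf : FormConverges A f u) : FormConverges A (fun n => c • f n) (c • u) := by
  rw [formConverges_iff hA] at *
  refine ⟨by simpa using hf.1.const_smul c, ?_⟩
  have h := hf.2.const_mul (Complex.normSq c)
  rw [mul_zero] at h
  refine h.congr fun p => ?_
  rw [← smul_sub, form_smul_left, form_smul_right, ← mul_assoc, mul_comm ((starRingEnd ℂ) c),
    Complex.mul_conj, Complex.re_ofReal_mul]

lemma formConverges_const (hA : IsSectorial A) (u : A.domain) :
    FormConverges A (fun _ => u) (u : H) := by
  rw [formConverges_iff hA]
  refine ⟨tendsto_const_nhds, ?_⟩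
  simp [form]

lemma FormConverges.sub (hA : IsSectorial A) {f g : ℕ → A.domain} {u v : H}
    (hf : FormConverges A f u) (hg : FormConverges A g v) :
    FormConverges A (fun n => f n - g n) (u - v) := by
  have := hf.add hA (hg.smul hA (-1))
  simpa [sub_eq_add_neg] using this

lemma FormConverges.exists_bound (hA : IsSectorial A) {f : ℕ → A.domain} {u : H}
    (hf : FormConverges A f u) :
    ∃ C : ℝ, 0 < C ∧ ∀ᶠ n in atTop, (form A (f n) (f n)).re ≤ C := by
  rw [formConverges_iff hA] at hf
  have h := hf.2.eventually (gt_mem_nhds (zero_lt_one' ℝ))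
  obtain ⟨⟨N, N'⟩, hN⟩ := eventually_atTop.1 h
  refine ⟨2 + 2 * (form A (f N') (f N')).re, by linarith [hA.re_nonneg (f N')], ?_⟩
  filter_upwards [eventually_ge_atTop N] with n hn
  have h1 := hN (n, N') ⟨hn, le_rfl⟩
  have h2 := hA.re_add_le (f n - f N') (f N')
  rw [sub_add_cancel] at h2
  simp only at h1
  linarith

/-- If the real part of the form stays bounded along `f` and tends to `0` along `g`, then the form
tends to `0` along `(f, g)` and along `(g, f)`. -/
lemma tendsto_form_zero (hA : IsSectorial A) {ι : Type*} {l : Filter ι} {f g : ι → A.domain}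
    {C : ℝ} (hC : 0 < C) (hf : ∀ᶠ i in l, (form A (f i) (f i)).re ≤ C)
    (hg : Tendsto (fun i => (form A (g i) (g i)).re) l (𝓝 0)) :
    Tendsto (fun i => form A (f i) (g i)) l (𝓝 0) ∧
      Tendsto (fun i => form A (g i) (f i)) l (𝓝 0) := by
  obtain ⟨M, hM, hb⟩ := hA.exists_bound'
  have main : ∀ ε > 0, ∀ᶠ i in l, ‖form A (f i) (g i)‖ < ε ∧ ‖form A (g i) (f i)‖ < ε := by
    intro ε hε
    set t : ℝ := ε / (2 * (M + 1) * C) with ht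
    have ht0 : 0 < t := by positivity
    have hMt : M * (t * C) < ε / 2 := by
      have e : t * C = ε / 2 / (M + 1) := by rw [ht]; field_simp
      rw [e, mul_div_assoc', div_lt_iff₀ (by positivity)]
      nlinarith
    have h1 := (hg.const_mul t⁻¹).const_mul M
    rw [mul_zero, mul_zero] at h1
    filter_upwards [hf, h1.eventually (gt_mem_nhds (half_pos hε))] with i hi hgi
    have hfi : M * (t * (form A (f i) (f i)).re) ≤ M * (t * C) := by gcongr
    have b1 := hb (f i) (g i) t ht0
    have b2 := hb (g i) (f i) t⁻¹ (inv_pos.2 ht0)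
    rw [inv_inv] at b2
    rw [mul_add] at b1 b2
    exact ⟨by linarith, by linarith⟩
  constructor <;> rw [Metric.tendsto_nhds] <;> intro ε hε <;>
    filter_upwards [main ε hε] with i hi <;> simp [hi.1, hi.2]

/-- Closability of the form of a sectorial operator. -/
lemma FormConverges.tendsto_zero (hA : IsSectorial A) {f : ℕ → A.domain}
    (hf : FormConverges A f 0) : Tendsto (fun n => (form A (f n) (f n)).re) atTop (𝓝 0) := by
  obtain ⟨C, hC, hb⟩ := hf.exists_bound hA
  rw [formConverges_iff hA] at hf
  have hb' : ∀ᶠ p : ℕ × ℕ in atTop, (form A (f p.1) (f p.1)).re ≤ C := by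
    rw [← prod_atTop_atTop_eq]
    exact tendsto_fst.eventually hb
  have h := (tendsto_form_zero hA hC hb' hf.2).1
  rw [Metric.tendsto_nhds]
  intro ε hε
  have h2 := (Metric.tendsto_nhds.1 h) (ε / 2) (half_pos hε)
  obtain ⟨⟨N, N'⟩, hN⟩ := eventually_atTop.1 h2
  have h3 : Tendsto (fun n => form A (f n) (f N')) atTop (𝓝 0) := by
    have := hf.1.inner (𝕜 := ℂ) (tendsto_const_nhds (x := A (f N')))
    simpa [form] using this
  filter_upwards [eventually_ge_atTop N, (Metric.tendsto_nhds.1 h3) (ε / 2) (half_pos hε)]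
    with n hn hn'
  have h4 := hN (n, N') ⟨hn, le_rfl⟩
  rw [dist_zero_right] at hn' h4 ⊢
  have e : form A (f n) (f n) = form A (f n) (f n - f N') + form A (f n) (f N') := by
    rw [form_sub_right]; ring
  calc ‖(form A (f n) (f n)).re‖ ≤ ‖form A (f n) (f n)‖ := Complex.abs_re_le_norm _
    _ ≤ ‖form A (f n) (f n - f N')‖ + ‖form A (f n) (f N')‖ := by
      rw [e]; exact norm_add_le _ _
    _ < ε := by linarith

/-- The form has a limit along any two form-convergent sequences. -/
lemma FormConverges.exists_tendsto (hA : IsSectorial A) {f g : ℕ → A.domain} {u v : H}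
    (hf : FormConverges A f u) (hg : FormConverges A g v) :
    ∃ z, Tendsto (fun n => form A (f n) (g n)) atTop (𝓝 z) := by
  obtain ⟨C, hC, hfb⟩ := hf.exists_bound hA
  obtain ⟨D, hD, hgb⟩ := hg.exists_bound hA
  rw [formConverges_iff hA] at hf hg
  refine cauchySeq_tendsto_of_complete ?_
  have h1 : Tendsto (fun p : ℕ × ℕ => form A (f p.2) (g p.1 - g p.2)) atTop (𝓝 0) := by
    refine (tendsto_form_zero hA hC ?_ hg.2).1
    rw [← prod_atTop_atTop_eq]
    exact tendsto_snd.eventually hfb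
  have h2 : Tendsto (fun p : ℕ × ℕ => form A (f p.1 - f p.2) (g p.1)) atTop (𝓝 0) := by
    refine (tendsto_form_zero hA hD ?_ hf.2).2
    rw [← prod_atTop_atTop_eq]
    exact tendsto_fst.eventually hgb
  rw [cauchySeq_iff_tendsto_dist_atTop_0]
  have h3 := (h2.add h1).norm
  rw [add_zero, norm_zero] at h3
  refine h3.congr fun p => ?_
  rw [dist_eq_norm, form_sub_left, form_sub_right]
  congr 1
  ring

/-- The limit of the form does not depend on the approximating sequences. -/
lemma FormConverges.tendsto_sub (hA : IsSectorial A) {f f' g g' : ℕ → A.domain} {u v : H}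
    (hf : FormConverges A f u) (hf' : FormConverges A f' u)
    (hg : FormConverges A g v) (hg' : FormConverges A g' v) :
    Tendsto (fun n => form A (f n) (g n) - form A (f' n) (g' n)) atTop (𝓝 0) := by
  obtain ⟨C, hC, hfb⟩ := hf'.exists_bound hA
  obtain ⟨D, hD, hgb⟩ := hg.exists_bound hA
  have d1 := hf.sub hA hf'
  have d2 := hg.sub hA hg'
  rw [sub_self] at d1 d2
  have h := (tendsto_form_zero hA hD hgb (d1.tendsto_zero hA)).2.add
    (tendsto_form_zero hA hC hfb (d2.tendsto_zero hA)).1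
  rw [add_zero] at h
  refine h.congr fun n => ?_
  rw [form_sub_left, form_sub_right]
  ring

end helpers

/-- The form domain `Q(A)`: the closure of `D(A)` with respect to the form norm, realised in `H`. -/
def formDomain (A : H →ₗ.[ℂ] H) (hA : IsSectorial A) : Submodule ℂ H where
  carrier := {u | ∃ f : ℕ → A.domain, FormConverges A f u}
  zero_mem' := ⟨fun _ => 0, by simpa using formConverges_const hA 0⟩
  add_mem' := fun ⟨_, hf⟩ ⟨_, hg⟩ => ⟨_, hf.add hA hg⟩
  smul_mem' := fun c _ ⟨_, hf⟩ => ⟨_, hf.smul hA c⟩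

/-- The closure on `Q(A)` of the form `(u, v) ↦ ⟨u, Av⟩`: the limit of `⟨u_n, A v_n⟩`, where `u_n`
and `v_n` are sequences in `D(A)` that converge to `u` and `v` in `H` and are Cauchy for the form
norm. The limit exists and does not depend on these sequences, see `tendsto_closedForm`. -/
def closedForm (A : H →ₗ.[ℂ] H) (hA : IsSectorial A) (u v : formDomain A hA) : ℂ :=
  limUnder atTop fun n => form A (u.2.choose n) (v.2.choose n)

lemma tendsto_closedForm {A : H →ₗ.[ℂ] H} (hA : IsSectorial A) (u v : formDomain A hA)
    {f g : ℕ → A.domain} (hf : FormConverges A f u) (hg : FormConverges A g v) :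
    Tendsto (fun n => form A (f n) (g n)) atTop (𝓝 (closedForm A hA u v)) := by
  have h := (u.2.choose_spec.exists_tendsto hA v.2.choose_spec)
  have h1 := tendsto_nhds_limUnder h
  have h2 := (hf.tendsto_sub hA u.2.choose_spec hg v.2.choose_spec).add h1
  rw [zero_add] at h2
  simpa [closedForm] using h2

lemma closedForm_add_right {A : H →ₗ.[ℂ] H} (hA : IsSectorial A) (u v w : formDomain A hA) :
    closedForm A hA u (v + w) = closedForm A hA u v + closedForm A hA u w := by
  obtain ⟨f, hf⟩ := u.2
  obtain ⟨g, hg⟩ := v.2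
  obtain ⟨k, hk⟩ := w.2
  refine tendsto_nhds_unique (tendsto_closedForm hA u (v + w) hf (hg.add hA hk)) ?_
  simpa only [form_add_right] using
    (tendsto_closedForm hA u v hf hg).add (tendsto_closedForm hA u w hf hk)

lemma closedForm_smul_right {A : H →ₗ.[ℂ] H} (hA : IsSectorial A) (c : ℂ)
    (u v : formDomain A hA) : closedForm A hA u (c • v) = c * closedForm A hA u v := by
  obtain ⟨f, hf⟩ := u.2
  obtain ⟨g, hg⟩ := v.2
  refine tendsto_nhds_unique (tendsto_closedForm hA u (c • v) hf (hg.smul hA c)) ?_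
  simpa only [form_smul_right] using (tendsto_closedForm hA u v hf hg).const_mul c

/-- The graph of the Friedrichs extension: all `(u, w)` with `u ∈ Q(A)` such that
`closedForm v u = ⟨v, w⟩` for all `v ∈ Q(A)`. -/
def friedrichsGraph (A : H →ₗ.[ℂ] H) (hA : IsSectorial A) : Submodule ℂ (H × H) where
  carrier := {p | ∃ u : formDomain A hA, (u : H) = p.1 ∧
    ∀ v : formDomain A hA, closedForm A hA v u = inner ℂ (v : H) p.2}
  zero_mem' := ⟨0, rfl, fun v => by
    have h := closedForm_smul_right hA 0 v 0
    rw [zero_smul, zero_mul] at h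
    simp [h]⟩
  add_mem' := by
    rintro p q ⟨u, hu, h⟩ ⟨u', hu', h'⟩
    exact ⟨u + u', by simp [hu, hu'], fun v => by
      rw [closedForm_add_right, h, h', Prod.snd_add, inner_add_right]⟩
  smul_mem' := by
    rintro c p ⟨u, hu, h⟩
    exact ⟨c • u, by simp [hu], fun v => by
      rw [closedForm_smul_right, h, Prod.smul_snd, inner_smul_right]⟩

/-- The Friedrichs extension `A_F` of a sectorial operator `A`: the operator associated with the
closure of the form `⟨u, Av⟩` by the first representation theorem. -/
def friedrichsExtension (A : H →ₗ.[ℂ] H) (hA : IsSectorial A) : H →ₗ.[ℂ] H :=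
  (friedrichsGraph A hA).toLinearPMap

lemma friedrichsExtension_graph (A : H →ₗ.[ℂ] H) (hA : IsSectorial A) :
    (friedrichsExtension A hA).graph = friedrichsGraph A hA := by
  refine Submodule.toLinearPMap_graph_eq _ ?_
  rintro ⟨x, w⟩ ⟨u, hu, h⟩ hx
  simp only at hu hx h
  have hu0 : u = 0 := Subtype.ext (hu.trans hx)
  have hz : ∀ v : formDomain A hA, inner ℂ (v : H) w = 0 := fun v => by
    have h1 := closedForm_smul_right hA 0 v 0
    rw [zero_smul, zero_mul] at h1
    rw [← h v, hu0, h1]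
  refine hA.dense_domain.eq_zero_of_inner_right (𝕜 := ℂ) fun v hv => ?_
  exact hz ⟨v, _, formConverges_const hA ⟨v, hv⟩⟩

/-- The Friedrichs extension is an extension. -/
lemma le_friedrichsExtension (A : H →ₗ.[ℂ] H) (hA : IsSectorial A) :
    A ≤ friedrichsExtension A hA := by
  refine LinearPMap.le_of_le_graph ?_
  rw [friedrichsExtension_graph]
  rintro ⟨x, y⟩ hxy
  obtain ⟨u, hu, hy⟩ := (LinearPMap.mem_graph_iff A).1 hxy
  simp only at hu hy
  have hc := formConverges_const hA u
  refine ⟨⟨u, _, hc⟩, hu, fun v => ?_⟩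
  obtain ⟨f, hf⟩ := v.2
  refine tendsto_nhds_unique (tendsto_closedForm hA v ⟨u, _, hc⟩ hf hc) ?_
  rw [← hy]
  exact hf.1.inner tendsto_const_nhds

end Basic

section Invariance

variable {H : Type*} [NormedAddCommGroup H] [InnerProductSpace ℂ H] [CompleteSpace H]

/-- The operator `K* T K` with its natural domain `{x | K x ∈ D(T)}`. -/
def conjBy (K : H →L[ℂ] H) (T : H →ₗ.[ℂ] H) : H →ₗ.[ℂ] H where
  domain := T.domain.comap (K : H →ₗ[ℂ] H)
  toFun :=
    { toFun := fun x => ContinuousLinearMap.adjoint K (T ⟨K x, x.2⟩)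
      map_add' := fun x y => by
        rw [← map_add, ← LinearPMap.map_add]
        congr 2
        exact Subtype.ext (by simp)
      map_smul' := fun c x => by
        rw [RingHom.id_apply, ← map_smul, ← LinearPMap.map_smul]
        congr 2
        exact Subtype.ext (by simp) }

/-- A densely defined closable operator `T` is `K`-invariant, for a bounded and boundedly invertible
`K`, if `K* T K = T` (equality of operators, domains included). -/
structure IsKInvariant (K : H ≃L[ℂ] H) (T : H →ₗ.[ℂ] H) : Prop where
  dense_domain : Dense (T.domain : Set H)
  isClosable : T.IsClosable
  conjBy_eq : conjBy (K : H →L[ℂ] H) T = T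

end Invariance

end KInv

end

namespace KInv

/-! ### Closability by accretivity, and transport of approximating sequences. -/

section Basic

variable {H : Type*} [NormedAddCommGroup H] [InnerProductSpace ℂ H]

/-! The identity `K* A K = A` makes `K` a bijection of `D(A)` that preserves the form: `⟨Ku, AKv⟩ =
⟨u, Av⟩`. As `K` is also bounded on `H`, it sends approximating sequences to approximating sequences
(`FormConverges.map`), and so does its inverse; hence both preserve `Q(A)` and the closed form `a`.
If `A_F u = w`, then for every `v ∈ Q(A)` `a[v, Ku] = a[K⁻¹v, u] = ⟨K⁻¹v, w⟩ = ⟨v, (K⁻¹)* w⟩`, so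
`A_F K u = (K⁻¹)* w`. Thus `(x, y) ↦ (Kx, (K⁻¹)* y)` maps the graph of `A_F` into itself
(`friedrichsGraph_map`). With the same statement for `K⁻¹`, this is `K`-invariance
(`conjBy_eq_iff`). Closability follows because `A_F` is accretive and its domain contains the dense
`D(A)`. -/

/-- A densely defined accretive operator is closable. -/
lemma isClosable_of_re_inner_nonneg {T : H →ₗ.[ℂ] H} (hd : Dense (T.domain : Set H))
    (hT : ∀ p ∈ T.graph, 0 ≤ (inner ℂ p.1 p.2).re) : T.IsClosable := by
  have hcl : ∀ p ∈ T.graph.topologicalClosure, 0 ≤ (inner ℂ p.1 p.2).re := by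
    intro p hp
    have hc : IsClosed {p : H × H | 0 ≤ (inner ℂ p.1 p.2).re} :=
      isClosed_le continuous_const (by fun_prop)
    exact closure_minimal hT hc hp
  refine ⟨T.graph.topologicalClosure.toLinearPMap, (Submodule.toLinearPMap_graph_eq _ ?_).symm⟩
  rintro ⟨x, w⟩ hx rfl
  have hpos : ∀ v ∈ (T.domain : Set H), 0 ≤ (inner ℂ v w).re := by
    intro v hv
    have hvT := T.graph.le_topologicalClosure (LinearPMap.mem_graph T ⟨v, hv⟩)
    -- Accretivity passes to the closed graph; apply it to `(0, w) + ε (v, Tv)` and divide by `ε`.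
    -- Letting `ε → 0+` removes the term in `Tv`.
    have key : ∀ ε : ℝ, 0 < ε →
        0 ≤ (inner ℂ v w).re + ε * (inner ℂ v (T ⟨v, hv⟩)).re := by
      intro ε hε
      have h := hcl _ (add_mem hx (Submodule.smul_mem _ (ε : ℂ) hvT))
      simp only [Prod.smul_mk, Prod.mk_add_mk, zero_add, inner_smul_left, inner_add_right,
        inner_smul_right, Complex.conj_ofReal, Complex.re_ofReal_mul, Complex.add_re] at h
      rw [← mul_add] at h
      exact nonneg_of_mul_nonneg_right h hε
    have hlim : Tendsto (fun ε : ℝ => (inner ℂ v w).re + ε * (inner ℂ v (T ⟨v, hv⟩)).re)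
        (𝓝[>] 0) (𝓝 ((inner ℂ v w).re + 0 * (inner ℂ v (T ⟨v, hv⟩)).re)) :=
      Tendsto.mono_left (Continuous.tendsto (by fun_prop) 0) nhdsWithin_le_nhds
    rw [zero_mul, add_zero] at hlim
    exact ge_of_tendsto hlim (eventually_mem_nhdsWithin.mono fun ε hε => key ε hε)
  have hall : ∀ v : H, 0 ≤ (inner ℂ v w).re := by
    have hc : IsClosed {v : H | 0 ≤ (inner ℂ v w).re} :=
      isClosed_le continuous_const (by fun_prop)
    exact fun v => closure_minimal hpos hc (hd v)
  -- The choice `v = -w` gives `-‖w‖² ≥ 0`.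
  have h := hall (-w)
  rw [inner_neg_left, inner_self_eq_norm_sq_to_K] at h
  norm_cast at h
  simp only [Complex.coe_algebraMap, Complex.ofReal_re] at h
  exact norm_eq_zero.1 (pow_eq_zero_iff two_ne_zero |>.1 (le_antisymm (by linarith) (sq_nonneg _)))

/-- Testing with `v = u` turns `⟨u, A_F u⟩` into the closed form at `(u, u)`, a limit of numbers
with nonnegative real part. -/
lemma friedrichsGraph_re_inner_nonneg {A : H →ₗ.[ℂ] H} (hA : IsSectorial A) :
    ∀ p ∈ friedrichsGraph A hA, 0 ≤ (inner ℂ p.1 p.2).re := by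
  rintro ⟨x, y⟩ ⟨u, rfl, h⟩
  obtain ⟨f, hf⟩ := u.2
  rw [← h u]
  exact ge_of_tendsto' ((Complex.continuous_re.tendsto _).comp (tendsto_closedForm hA u u hf hf))
    fun n => hA.re_nonneg (f n)

/-- `K` need not be an isometry of `H`, so the two parts of the form norm are treated apart:
continuity of `K` gives convergence in `H`, and invariance of the form gives the Cauchy condition.
-/
lemma FormConverges.map {K : H ≃L[ℂ] H} {A : H →ₗ.[ℂ] H} (hA : IsSectorial A)
    {U : A.domain →ₗ[ℂ] A.domain} (hU : ∀ u, (U u : H) = K u)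
    (hform : ∀ u v, form A (U u) (U v) = form A u v) {f : ℕ → A.domain} {u : H}
    (hf : FormConverges A f u) : FormConverges A (fun n => U (f n)) (K u) := by
  rw [formConverges_iff hA] at hf ⊢
  refine ⟨?_, ?_⟩
  · simp only [hU]
    exact (K.continuous.tendsto u).comp hf.1
  · simpa only [← map_sub, hform] using hf.2

end Basic

/-! ### Invariance as a property of graphs, and its transfer to the Friedrichs extension. -/

section Invariance

variable {H : Type*} [NormedAddCommGroup H] [InnerProductSpace ℂ H] [CompleteSpace H]

lemma mem_graph_conjBy {K : H →L[ℂ] H} {T : H →ₗ.[ℂ] H} {x y : H} :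
    (x, y) ∈ (conjBy K T).graph ↔
      ∃ z, (K x, z) ∈ T.graph ∧ ContinuousLinearMap.adjoint K z = y := by
  rw [LinearPMap.mem_graph_iff]
  constructor
  · rintro ⟨u, rfl, rfl⟩
    exact ⟨T ⟨K u, u.2⟩, LinearPMap.mem_graph T ⟨K u, u.2⟩, rfl⟩
  · rintro ⟨z, hz, rfl⟩
    obtain ⟨v, hv, rfl⟩ := (LinearPMap.mem_graph_iff T).1 hz
    have hx : K x ∈ T.domain := by
      rw [show K x = v from hv.symm]
      exact v.2
    refine ⟨⟨x, hx⟩, rfl, ?_⟩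
    change ContinuousLinearMap.adjoint K (T ⟨K x, hx⟩) = _
    congr 2
    exact Subtype.ext hv.symm

/-- `K* (K⁻¹)* = (K⁻¹ K)* = 1`. -/
lemma adjoint_adjoint_symm (K : H ≃L[ℂ] H) (y : H) :
    ContinuousLinearMap.adjoint (K : H →L[ℂ] H)
      (ContinuousLinearMap.adjoint (K.symm : H →L[ℂ] H) y) = y := by
  refine ext_inner_left ℂ fun v => ?_
  simp [ContinuousLinearMap.adjoint_inner_right]

/-- `K* T K = T` says that the graph of `T` is invariant under `(x, y) ↦ (K x, K⁻¹* y)` and under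
its inverse. -/
lemma conjBy_eq_iff (K : H ≃L[ℂ] H) (T : H →ₗ.[ℂ] H) :
    conjBy (K : H →L[ℂ] H) T = T ↔
      (∀ x y, (x, y) ∈ T.graph →
        (K x, ContinuousLinearMap.adjoint (K.symm : H →L[ℂ] H) y) ∈ T.graph) ∧
      (∀ x y, (x, y) ∈ T.graph →
        (K.symm x, ContinuousLinearMap.adjoint (K : H →L[ℂ] H) y) ∈ T.graph) := by
  constructor
  · intro h
    refine ⟨fun x y hxy => ?_, fun x y hxy => ?_⟩
    · rw [← h, mem_graph_conjBy] at hxy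
      obtain ⟨z, hz, rfl⟩ := hxy
      -- Here `y = K* z`, and `(K⁻¹)* K* z = z`.
      have e := adjoint_adjoint_symm K.symm z
      rw [K.symm_symm] at e
      rwa [e]
    · rw [← h, mem_graph_conjBy]
      exact ⟨y, by simpa using hxy, rfl⟩
  · rintro ⟨h1, h2⟩
    refine LinearPMap.eq_of_eq_graph (Submodule.ext ?_)
    rintro ⟨x, y⟩
    rw [mem_graph_conjBy]
    constructor
    · rintro ⟨z, hz, rfl⟩
      simpa using h2 _ _ hz
    · exact fun h => ⟨_, h1 x y h, adjoint_adjoint_symm K y⟩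

/-- Invariance of the form: an operator `K` whose graph action preserves `A` maps form-convergent
sequences to form-convergent sequences and preserves the form. -/
lemma exists_form_isometry {K : H ≃L[ℂ] H} {A : H →ₗ.[ℂ] H}
    (hK : ∀ x y, (x, y) ∈ A.graph →
      (K x, ContinuousLinearMap.adjoint (K.symm : H →L[ℂ] H) y) ∈ A.graph) :
    ∃ U : A.domain →ₗ[ℂ] A.domain, (∀ u, (U u : H) = K u) ∧
      ∀ u v, form A (U u) (U v) = form A u v := by
  have hdom : ∀ u ∈ A.domain, (K : H →L[ℂ] H) u ∈ A.domain := fun u hu =>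
    LinearPMap.mem_domain_of_mem_graph (hK _ _ (LinearPMap.mem_graph A ⟨u, hu⟩))
  refine ⟨((K : H →L[ℂ] H) : H →ₗ[ℂ] H).restrict hdom, fun u => rfl, fun u v => ?_⟩
  obtain ⟨w, hw, e⟩ := (LinearPMap.mem_graph_iff A).1 (hK _ _ (LinearPMap.mem_graph A v))
  have hw' : w = ((K : H →L[ℂ] H) : H →ₗ[ℂ] H).restrict hdom v := Subtype.ext hw
  -- Since `A K v = (K⁻¹)* A v`, moving the adjoint to the left factor leaves `K⁻¹ K u`.
  rw [form, ← hw', e, ContinuousLinearMap.adjoint_inner_right]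
  change inner ℂ (K.symm (K u)) _ = _
  rw [K.symm_apply_apply, form]

/-- Both directions of invariance enter: `hK` carries `u` forward to `K u`, while `hK'` pulls the
test vector `v` back to `K⁻¹ v` inside `Q(A)`. -/
lemma friedrichsGraph_map {K : H ≃L[ℂ] H} {A : H →ₗ.[ℂ] H} (hA : IsSectorial A)
    (hK : ∀ x y, (x, y) ∈ A.graph →
      (K x, ContinuousLinearMap.adjoint (K.symm : H →L[ℂ] H) y) ∈ A.graph)
    (hK' : ∀ x y, (x, y) ∈ A.graph →
      (K.symm x, ContinuousLinearMap.adjoint (K : H →L[ℂ] H) y) ∈ A.graph)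
    (x y : H) (hxy : (x, y) ∈ friedrichsGraph A hA) :
    (K x, ContinuousLinearMap.adjoint (K.symm : H →L[ℂ] H) y) ∈ friedrichsGraph A hA := by
  obtain ⟨U, hU, hform⟩ := exists_form_isometry hK
  obtain ⟨V, hV, hform'⟩ := exists_form_isometry (K := K.symm) hK'
  obtain ⟨u, rfl, h⟩ := hxy
  obtain ⟨f, hf⟩ := u.2
  have hKf := hf.map hA hU hform
  refine ⟨⟨K u, _, hKf⟩, rfl, fun v => ?_⟩
  obtain ⟨g, hg⟩ := v.2
  have hVg := hg.map hA hV hform'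
  rw [ContinuousLinearMap.adjoint_inner_right]
  refine Eq.trans ?_ (h ⟨K.symm v, _, hVg⟩)
  have h1 := tendsto_closedForm hA v ⟨K u, _, hKf⟩ hg hKf
  have h2 := tendsto_closedForm hA ⟨K.symm v, _, hVg⟩ u hVg hf
  refine tendsto_nhds_unique h1 (h2.congr fun n => ?_)
  -- Along the sequences, `form (V g) (f) = form (U V g) (U f) = form g (U f)`, so both limits
  -- agree.
  have hUV : U (V (g n)) = g n := Subtype.ext (by rw [hU, hV, K.apply_symm_apply])
  rw [← hform, hUV]

end Invariance

end KInv

theorem mainTheorem3 {H : Type*} [NormedAddCommGroup H] [InnerProductSpace ℂ H] [CompleteSpace H]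
    (K : H ≃L[ℂ] H) (A : H →ₗ.[ℂ] H) (hA : KInv.IsSectorial A)
    (hKA : KInv.conjBy (K : H →L[ℂ] H) A = A) :
    KInv.IsKInvariant K (KInv.friedrichsExtension A hA) := by
  have hd : Dense ((KInv.friedrichsExtension A hA).domain : Set H) :=
    hA.dense_domain.mono (KInv.le_friedrichsExtension A hA).1
  refine ⟨hd, KInv.isClosable_of_re_inner_nonneg hd ?_, ?_⟩
  · rw [KInv.friedrichsExtension_graph]
    exact KInv.friedrichsGraph_re_inner_nonneg hA
  · obtain ⟨h1, h2⟩ := (KInv.conjBy_eq_iff K A).1 hKA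
    rw [KInv.conjBy_eq_iff, KInv.friedrichsExtension_graph]
    -- For `K.symm` the two invariance hypotheses exchange roles.
    exact ⟨KInv.friedrichsGraph_map hA h1 h2, KInv.friedrichsGraph_map (K := K.symm) hA h2 h1⟩
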